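/- Let $N\ge 1$ be an integer, $0<s<1$, $2\le p<N/s$ and $p^*=\frac{Np}{N-sp}$. For measurable $u:\mathbb R^N\to\mathbb R$ put $$[u]_{s,p}=\Big(\int_{\mathbb R^N}\int_{\mathbb R^N}\frac{|u(x)-u(y)|^p}{|x-y|^{N+sp}}\,dx\,dy\Big)^{1/p},\qquad D^{s,p}(\mathbb R^N)=\{u\in L^{p^*}(\mathbb R^N):[u]_{s,p}<\infty\}.$$ A function $u\in D^{s,p}(\mathbb R^N)$ is called a (weak) solution of $(-\Delta_p)^s u=g(x,u)$ in $\mathbb R^N$ if for every $v\in D^{s,p}(\mathbb R^N)$ the function $g(\cdot,u)v$ is integrable and $$\int_{\mathbb R^N}\int_{\mathbb R^N}\frac{|u(x)-u(y)|^{p-2}(u(x)-u(y))(v(x)-v(y))}{|x-y|^{N+sp}}\,dx\,dy=\int_{\mathbb R^N}g(x,u)\,v\,dx .$$ Then there is $\theta_0=\theta_0(p,N,s)\in(0,1]$, and for every real $\gamma$ with $1\le\gamma<p^*$ there is a function $C=C_{p,\gamma,N,s}:[0,\infty)^2\to[0,\infty)$, nondecreasing in each of its two variables, such that the following holds. Let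 $a\in L^1(\mathbb R^N)\cap L^\infty(\mathbb R^N)$, $\|a\|:=\|a\|_1+\|a\|_\infty$, and let $g:\mathbb R^N\times\mathbb R\to\mathbb R$ be a Carathéodory function with $$|g(x,t)|\le |a(x)|\big(1+|t|^{\gamma-1}\big)\qquad\text{for a.e. }x\in\mathbb R^N\text{ and all }t\in\mathbb R .$$ Then every solution $u\in D^{s,p}(\mathbb R^N)$ of $(-\Delta_p)^s u=g(x,u)$ in $\mathbb R^N$ satisfies $$\|u\|_\infty\le C\big(\|a\|,[u]_{s,p}\big)\,\max\big\{\|u\|_{p^*}^{\theta_0},\ \|u\|_{p^*}\big\}.$$ -/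

import Mathlib

open MeasureTheory
open scoped NNReal ENNReal

namespace FracPLaplace

noncomputable section

/-- The Euclidean space `ℝ^N`. -/
abbrev RN (N : ℕ) : Type := EuclideanSpace ℝ (Fin N)

/-- The fractional critical Sobolev exponent `p^* = N p / (N - s p)`. -/
def critExp (N : ℕ) (s p : ℝ) : ℝ := N * p / (N - s * p)

/-- The Gagliardo seminorm
`[u]_{s,p} = (∬ |u(x) - u(y)|^p / |x - y|^(N + s p) dx dy)^(1/p)`, with values in `[0, ∞]`.
(The integral is over the product space; the diagonal, where the integrand is read as `0`,
is a null set.) -/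
def gagliardo (N : ℕ) (s p : ℝ) (u : RN N → ℝ) : ℝ≥0∞ :=
  (∫⁻ z : RN N × RN N,
    ENNReal.ofReal (|u z.1 - u z.2| ^ p / ‖z.1 - z.2‖ ^ ((N : ℝ) + s * p))) ^ (1 / p)

/-- Membership in the homogeneous fractional Sobolev space
`D^{s,p}(ℝ^N) = {u ∈ L^{p^*}(ℝ^N) : [u]_{s,p} < ∞}`. -/
def MemD (N : ℕ) (s p : ℝ) (u : RN N → ℝ) : Prop :=
  MemLp u (ENNReal.ofReal (critExp N s p)) volume ∧ gagliardo N s p u < ∞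

/-- The pairing `⟨(-Δ_p)^s u, v⟩`. For `u, v ∈ D^{s,p}(ℝ^N)` the integrand is integrable by
Hölder's inequality. -/
def pairing (N : ℕ) (s p : ℝ) (u v : RN N → ℝ) : ℝ :=
  ∫ z : RN N × RN N,
    |u z.1 - u z.2| ^ (p - 2) * (u z.1 - u z.2) * (v z.1 - v z.2)
      / ‖z.1 - z.2‖ ^ ((N : ℝ) + s * p)

/-- `u` is a weak solution in `D^{s,p}(ℝ^N)` of `(-Δ_p)^s u = f(x, u)`: the right-hand side
`∫ f(x, u) v dx` makes sense and equals `⟨(-Δ_p)^s u, v⟩` for every `v ∈ D^{s,p}(ℝ^N)`. -/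
def IsWeakSolution (N : ℕ) (s p : ℝ) (f : RN N → ℝ → ℝ) (u : RN N → ℝ) : Prop :=
  MemD N s p u ∧ ∀ v : RN N → ℝ, MemD N s p v →
    Integrable (fun x => f x (u x) * v x) volume ∧
      pairing N s p u v = ∫ x, f x (u x) * v x

/-- Carathéodory functions: `x ↦ g(x, t)` is (Lebesgue) measurable for every `t`, and
`t ↦ g(x, t)` is continuous for almost every `x`. -/
def IsCaratheodory (N : ℕ) (g : RN N → ℝ → ℝ) : Prop :=
  (∀ t : ℝ, AEMeasurable (fun x => g x t) volume) ∧
    ∀ᵐ x : RN N, Continuous (g x)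

/-- Hypothesis (Hg): `g` is a Carathéodory function with
`|g(x, t)| ≤ |a(x)| (1 + |t|^(γ - 1))`. -/
def HypG (N : ℕ) (γ : ℝ) (a : RN N → ℝ) (g : RN N → ℝ → ℝ) : Prop :=
  IsCaratheodory N g ∧ ∀ᵐ x : RN N, ∀ t : ℝ, |g x t| ≤ |a x| * (1 + |t| ^ (γ - 1))

/-- `‖a‖ = ‖a‖_1 + ‖a‖_∞`, with values in `[0, ∞]`. -/
def normOneInfty (N : ℕ) (a : RN N → ℝ) : ℝ≥0∞ :=
  eLpNorm a 1 volume + eLpNorm a ∞ volume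

end

end FracPLaplace

namespace FracPLaplace

/-! De Giorgi iteration. Write `q = p^*` and `σ = sp/N`, so that `p + qσ = q`. Testing the equation
with `(u - k)₊` bounds the energy of the truncation by `A ∫ (1 + |u|^(γ-1)) (u - k)₊`
(`energy_truncation_le`). Sobolev, in the form `I ≤ K I^σ E` (`powInt_le_energy`), turns this into a
bound on `∫ (u - k)₊^q`. Along the levels `M (1 - 2^{-j})`, subcriticality `γ < q` lets the right
side be absorbed into the previous `q`-integral (`levelset_growth_bound`), so `y_{j+1}^(1-σ) ≤ L b^j
y_j`. This recursion is superlinear, hence `y_j → 0` once `L y_0^σ` is small (`geometric_decay`),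
and then `u ≤ M`; applying this to `-u` bounds `|u|`.

Smallness holds for `M` a constant times the larger of two powers of `‖u‖_q`. The power that depends
on `γ` is traded for `[u]_{s,p}` by Sobolev (`max_rpow_le`). -/

/-- The `p`-th power of the Gagliardo seminorm. -/
noncomputable def energy (N : ℕ) (s p : ℝ) (u : RN N → ℝ) : ℝ≥0∞ :=
  ∫⁻ z : RN N × RN N,
    ENNReal.ofReal (|u z.1 - u z.2| ^ p / ‖z.1 - z.2‖ ^ ((N : ℝ) + s * p))

theorem gagliardo_eq_energy_rpow (N : ℕ) (s p : ℝ) (u : RN N → ℝ) :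
    gagliardo N s p u = energy N s p u ^ (1 / p) := rfl

/-- The integral of the `q`-th power of a function. -/
noncomputable def powInt (N : ℕ) (q : ℝ) (u : RN N → ℝ) : ℝ≥0∞ :=
  ∫⁻ x : RN N, ENNReal.ofReal (|u x| ^ q)

/-! ### Fractional Sobolev inequality -/

theorem exponent_identity {N s p : ℝ} (hN : 0 < N) (h : s * p < N) :
    p + N * p / (N - s * p) * (s * p / N) = N * p / (N - s * p) := by
  have : N - s * p ≠ 0 := by linarith
  rw [show N * p / (N - s * p) * (s * p / N) = p * (s * p) / (N - s * p) by field_simp,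
    eq_div_iff this, add_mul, div_mul_cancel₀ _ this]
  ring

theorem powInt_superlevel_le {N : ℕ} {q : ℝ} (hq : 0 < q) {w : RN N → ℝ}
    (hw : AEMeasurable w) {τ : ℝ} (hτ : 0 < τ) :
    ENNReal.ofReal (τ ^ q) * volume {y | τ ≤ |w y|} ≤ powInt N q w := by
  have h := mul_meas_ge_le_lintegral₀ (μ := (volume : Measure (RN N)))
    (f := fun x => ENNReal.ofReal (|w x| ^ q)) (by fun_prop) (ENNReal.ofReal (τ ^ q))
  refine le_trans ?_ h
  gcongr
  exact fun hy => ENNReal.ofReal_le_ofReal (Real.rpow_le_rpow hτ.le hy hq.le)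

/-- The volume of the unit ball of `ℝ^N`. -/
noncomputable def ballVol (N : ℕ) : ℝ := (volume (Metric.ball (0 : RN N) 1)).toReal

theorem ballVol_pos (N : ℕ) : 0 < ballVol N :=
  ENNReal.toReal_pos (Metric.measure_ball_pos _ _ one_pos).ne' measure_ball_lt_top.ne

theorem volume_ball_eq (N : ℕ) (x : RN N) {r : ℝ} (hr : 0 < r) :
    volume (Metric.ball x r) = ENNReal.ofReal (ballVol N * r ^ N) := by
  rw [Measure.addHaar_ball_of_pos _ _ hr, ENNReal.ofReal_mul (ballVol_pos N).le, ballVol,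
    ENNReal.ofReal_toReal measure_ball_lt_top.ne, mul_comm]
  simp

/-- The constant of the fractional Sobolev inequality. -/
noncomputable def sobolevConst (N : ℕ) (q σ : ℝ) : ℝ := 2 ^ q * (2 / ballVol N) ^ (1 + σ)

theorem sobolevConst_pos (N : ℕ) (q σ : ℝ) : 0 < sobolevConst N q σ := by
  have := ballVol_pos N
  unfold sobolevConst
  positivity

/-- By Chebyshev, `|w| ≥ |w x| / 2` only on a set of measure at most `V`. A ball around `x` of
volume `2V` thus contains measure at least `V` of points where `w` differs from `w x` by at least
`|w x| / 2`, which bounds the slice integral from below. Integrating over `x` gives Sobolev. -/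
theorem abs_rpow_le_energy_slice {N : ℕ} {s p q σ : ℝ} (hN : 0 < N) (hp : 0 < p)
    (hq : 0 < q) (hs : 0 < s) (hσ : σ = s * p / N) (hqσ : p + q * σ = q)
    {w : RN N → ℝ} (hw : AEMeasurable w) {I : ℝ} (hI : 0 < I)
    (hwI : powInt N q w = ENNReal.ofReal I) (x : RN N) :
    ENNReal.ofReal (|w x| ^ q) ≤ ENNReal.ofReal (sobolevConst N q σ * I ^ σ) *
      ∫⁻ y, ENNReal.ofReal (|w x - w y| ^ p / ‖x - y‖ ^ ((N : ℝ) + s * p)) := by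
  rcases (abs_nonneg (w x)).eq_or_lt with h0 | ht
  · rw [← h0, Real.zero_rpow hq.ne']; simp
  set t := |w x| with htdef
  set ω := ballVol N with hω
  have hωpos : 0 < ω := ballVol_pos N
  set V : ℝ := I / (t / 2) ^ q with hV
  have hVpos : 0 < V := by positivity
  have hNR : (0 : ℝ) < N := by exact_mod_cast hN
  set r : ℝ := (2 * V / ω) ^ (1 / (N : ℝ)) with hr
  have hrpos : 0 < r := by positivity
  have hrN : r ^ N = 2 * V / ω := by
    rw [hr, ← Real.rpow_natCast, ← Real.rpow_mul (by positivity)]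
    rw [one_div, inv_mul_cancel₀ hNR.ne', Real.rpow_one]
  have hball : volume (Metric.ball x r) = ENNReal.ofReal (2 * V) := by
    rw [volume_ball_eq N x hrpos, hrN]
    rw [← hω, mul_div_cancel₀ _ hωpos.ne']
  have hsup : volume {y | t / 2 ≤ |w y|} ≤ ENNReal.ofReal V := by
    have h := powInt_superlevel_le hq hw (τ := t / 2) (by positivity)
    rw [hwI] at h
    rw [hV, ENNReal.ofReal_div_of_pos (by positivity), ENNReal.le_div_iff_mul_le, mul_comm]
    · exact h
    · left; simp; positivity
    · left; simp
  have hE : ENNReal.ofReal V ≤ volume (Metric.ball x r \ {y | t / 2 ≤ |w y|}) := by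
    refine le_trans ?_ (le_measure_sdiff (μ := volume))
    rw [hball]
    refine le_trans ?_ (tsub_le_tsub_left hsup _)
    rw [← ENNReal.ofReal_sub _ hVpos.le]
    apply ENNReal.ofReal_le_ofReal; linarith
  set c : ℝ := (t / 2) ^ p / r ^ ((N : ℝ) + s * p) with hc
  have hcpos : 0 < c := by positivity
  have hG := mul_meas_ge_le_lintegral₀ (μ := (volume : Measure (RN N)))
    (f := fun y => ENNReal.ofReal (|w x - w y| ^ p / ‖x - y‖ ^ ((N : ℝ) + s * p)))
    (by fun_prop) (ENNReal.ofReal c)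
  have hsub : Metric.ball x r \ {y | t / 2 ≤ |w y|} ⊆
      {y | ENNReal.ofReal c ≤
        ENNReal.ofReal (|w x - w y| ^ p / ‖x - y‖ ^ ((N : ℝ) + s * p))} := by
    rintro y ⟨hy1, hy2⟩
    simp only [Set.mem_ofPred_eq, not_le] at hy2
    have hd : ‖x - y‖ < r := by
      rw [← dist_eq_norm, dist_comm]; exact hy1
    have hxy : x ≠ y := by
      rintro rfl
      rw [← htdef] at hy2; linarith
    have hn : 0 < ‖x - y‖ := norm_pos_iff.2 (sub_ne_zero.2 hxy)
    have hdiff : t / 2 ≤ |w x - w y| := by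
      have := abs_sub_abs_le_abs_sub (w x) (w y); linarith
    apply ENNReal.ofReal_le_ofReal
    rw [hc]
    gcongr
  have hmain : ENNReal.ofReal (c * V) ≤
      ∫⁻ y, ENNReal.ofReal (|w x - w y| ^ p / ‖x - y‖ ^ ((N : ℝ) + s * p)) := by
    refine le_trans ?_ hG
    rw [ENNReal.ofReal_mul hcpos.le]
    gcongr
    exact hE.trans (measure_mono hsub)
  refine le_trans (le_of_eq ?_) (mul_le_mul_right hmain _)
  rw [← ENNReal.ofReal_mul (by have := sobolevConst_pos N q σ; positivity)]
  congr 1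
  have hrp : r ^ ((N : ℝ) + s * p) = (2 / ω) ^ (1 + σ) * (V * V ^ σ) := by
    have : (N : ℝ) + s * p = N * (1 + σ) := by rw [hσ]; field_simp
    rw [this, Real.rpow_mul hrpos.le, Real.rpow_natCast, hrN,
      show 2 * V / ω = (2 / ω) * V by ring, Real.mul_rpow (by positivity) hVpos.le,
      Real.rpow_add hVpos, Real.rpow_one]
  have hVσ : V ^ σ = I ^ σ / (t / 2) ^ (q * σ) := by
    rw [hV, Real.div_rpow hI.le (by positivity), ← Real.rpow_mul (by positivity)]
  have htq : t ^ q = 2 ^ q * ((t / 2) ^ p * (t / 2) ^ (q * σ)) := by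
    rw [← Real.rpow_add (by positivity), hqσ, ← Real.mul_rpow (by norm_num) (by positivity)]
    congr 1; ring
  rw [hc, hrp, hVσ, htq, sobolevConst, ← hω]
  have h1 : (2 / ω) ^ (1 + σ) ≠ 0 := by positivity
  have h2 : I ^ σ ≠ 0 := by positivity
  have h3 : (t / 2) ^ (q * σ) ≠ 0 := by positivity
  generalize (2 / ω) ^ (1 + σ) = X at *
  generalize I ^ σ = Y at *
  generalize (t / 2) ^ (q * σ) = Z at *
  field_simp

theorem aemeasurable_energy_integrand {N : ℕ} (s p : ℝ) {w : RN N → ℝ} (hw : AEMeasurable w) :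
    AEMeasurable (fun z : RN N × RN N =>
      ENNReal.ofReal (|w z.1 - w z.2| ^ p / ‖z.1 - z.2‖ ^ ((N : ℝ) + s * p)))
      (volume.prod volume) := by
  have h1 : AEMeasurable (fun z : RN N × RN N => w z.1) (volume.prod volume) :=
    hw.comp_quasiMeasurePreserving Measure.quasiMeasurePreserving_fst
  have h2 : AEMeasurable (fun z : RN N × RN N => w z.2) (volume.prod volume) :=
    hw.comp_quasiMeasurePreserving Measure.quasiMeasurePreserving_snd
  fun_prop

/-- The fractional Sobolev inequality in the form `I ≤ K I^σ [w]^p` with `I = ∫ |w|^{p^*}`. -/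
theorem powInt_le_energy {N : ℕ} {s p q σ : ℝ} (hN : 0 < N) (hp : 0 < p)
    (hq : 0 < q) (hs : 0 < s) (hσ : σ = s * p / N) (hqσ : p + q * σ = q)
    {w : RN N → ℝ} (hw : AEMeasurable w) (hfin : powInt N q w ≠ ∞) :
    powInt N q w ≤ ENNReal.ofReal (sobolevConst N q σ * (powInt N q w).toReal ^ σ) *
      energy N s p w := by
  rcases eq_or_ne (powInt N q w) 0 with h0 | h0
  · rw [h0]; exact zero_le
  have hI : 0 < (powInt N q w).toReal := ENNReal.toReal_pos h0 hfin
  have hb := fun x => abs_rpow_le_energy_slice hN hp hq hs hσ hqσ hw hI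
    (ENNReal.ofReal_toReal hfin).symm x
  calc powInt N q w ≤ _ := lintegral_mono hb
    _ = _ := by
      rw [lintegral_const_mul' _ _ ENNReal.ofReal_ne_top, energy, Measure.volume_eq_prod,
        lintegral_prod _ (aemeasurable_energy_integrand s p hw)]

/-! ### Real inequalities behind the iteration -/

/-- Where the next truncation is positive, the current one is at least the gap `M 2^{-(j+1)}`
between levels, so its lower powers are controlled by its `q`-th power. -/
theorem levelset_growth_bound {M γ q u : ℝ} (hM : 0 < M) (hγ : 1 ≤ γ) (hγq : γ < q) (j : ℕ) :
    (1 + |u| ^ (γ - 1)) * max (u - M * (1 - (1 / 2) ^ (j + 1))) 0 ≤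
      4 ^ q * (2 ^ q) ^ j * (M ^ (1 - q) + M ^ (γ - q)) *
        |max (u - M * (1 - (1 / 2) ^ j)) 0| ^ q := by
  have hhalf : (0 : ℝ) < (1 / 2) ^ j := by positivity
  rcases le_or_gt (u - M * (1 - (1 / 2) ^ (j + 1))) 0 with h | h
  · rw [max_eq_right h, mul_zero]; positivity
  set m : ℝ := M * (1 / 2) ^ (j + 1) with hm
  have hmpos : 0 < m := by positivity
  set t := u - M * (1 - (1 / 2) ^ j) with ht
  have hmt : m ≤ t := by
    rw [hm, ht]; rw [pow_succ] at h ⊢; nlinarith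
  have htpos : 0 < t := hmpos.trans_le hmt
  -- The gap is `2M/B`; the spare factor 2 yields `u ≤ t + M ≤ B t`. The constant `4^q (2^q)^j` is
  -- `B^q`.
  set B : ℝ := 2 ^ (j + 2) with hB
  have hBpos : 0 < B := by positivity
  have hB1 : 1 ≤ B := one_le_pow₀ (by norm_num)
  have hmB : M = m * B / 2 := by
    rw [hm, hB, pow_succ, pow_add, one_div, inv_pow]; field_simp
  have hle1 : (1 / 2 : ℝ) ^ (j + 1) ≤ 1 := pow_le_one₀ (by norm_num) (by norm_num)
  have hupos : 0 < u := by nlinarith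
  have hB4 : 4 ≤ B := by
    rw [hB, pow_add]
    have : (1 : ℝ) ≤ 2 ^ j := one_le_pow₀ (by norm_num)
    linarith
  have huB : u ≤ B * t := by
    have h1 : u ≤ t + M := by rw [ht]; nlinarith
    have h2 : M ≤ B / 2 * t := by rw [hmB]; nlinarith
    nlinarith
  have hMB : M / B ≤ m := by rw [hmB]; field_simp; norm_num
  have key : ∀ ρ : ℝ, 1 ≤ ρ → ρ ≤ q → t ^ ρ * B ^ (ρ - 1) ≤ B ^ q * M ^ (ρ - q) * t ^ q := by
    intro ρ h1 h2
    have e1 : t ^ ρ ≤ t ^ q * (M / B) ^ (ρ - q) := by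
      rw [show t ^ ρ = t ^ q * t ^ (ρ - q) by rw [← Real.rpow_add htpos]; congr 1; ring]
      gcongr ?_ * ?_
      exact Real.rpow_le_rpow_of_nonpos (by positivity) (hMB.trans hmt) (by linarith)
    calc t ^ ρ * B ^ (ρ - 1) ≤ t ^ q * (M / B) ^ (ρ - q) * B ^ (ρ - 1) := by gcongr
      _ = B ^ (q - 1) * M ^ (ρ - q) * t ^ q := by
        rw [Real.div_rpow hM.le hBpos.le,
          show B ^ (ρ - 1) = B ^ (q - 1) * B ^ (ρ - q) by
            rw [← Real.rpow_add hBpos]; congr 1; ring]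
        field_simp
      _ ≤ _ := by gcongr; linarith
  have hBq : B ^ q = 4 ^ q * (2 ^ q) ^ j := by
    rw [hB, pow_add, Real.mul_rpow (by positivity) (by norm_num),
      ← Real.rpow_pow_comm (by norm_num) q j]
    norm_num
    ring
  have hw : max (u - M * (1 - (1 / 2) ^ (j + 1))) 0 ≤ t := by
    rw [max_eq_left h.le, ht, pow_succ]; nlinarith
  rw [max_eq_left htpos.le, abs_of_pos hupos, abs_of_pos htpos, ← hBq]
  calc _ ≤ (1 + (B * t) ^ (γ - 1)) * t := by
        gcongr
    _ = t ^ (1 : ℝ) * B ^ ((1 : ℝ) - 1) + t ^ γ * B ^ (γ - 1) := by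
        rw [Real.mul_rpow hBpos.le htpos.le, sub_self, Real.rpow_zero, Real.rpow_one,
          show t ^ γ = t ^ (γ - 1) * t by
            rw [← Real.rpow_add_one htpos.ne']; congr 1; ring]
        ring
    _ ≤ B ^ q * M ^ (1 - q) * t ^ q + B ^ q * M ^ (γ - q) * t ^ q :=
        add_le_add (key 1 le_rfl (by linarith)) (key γ hγ hγq.le)
    _ = _ := by ring

theorem geometric_decay {y : ℕ → ℝ} {σ b L : ℝ} (hy : ∀ j, 0 ≤ y j) (hσ : 0 < σ)
    (hσ1 : σ < 1) (hb : 1 < b) (hL : 0 ≤ L)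
    (hrec : ∀ j, y (j + 1) ≤ y (j + 1) ^ σ * (L * b ^ j * y j))
    (h0 : L * y 0 ^ σ ≤ b ^ (-((1 - σ) / σ))) (j : ℕ) :
    y j ≤ y 0 * (b ^ (-(1 / σ))) ^ j := by
  have hb0 : 0 < b := by linarith
  set ρ := b ^ (-(1 / σ)) with hρ
  have hρpos : 0 < ρ := by positivity
  induction j with
  | zero => simp
  | succ j ih =>
    rcases (hy (j + 1)).eq_or_lt with h | h
    · rw [← h]; have := hy 0; positivity
    rcases (hy 0).eq_or_lt with h00 | h00
    · rw [← h00, zero_mul] at ih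
      have : y j = 0 := le_antisymm ih (hy j)
      have h2 := hrec j
      rw [this, mul_zero, mul_zero] at h2
      linarith
    have e1 : y (j + 1) ^ (1 - σ) ≤ L * b ^ j * y j := by
      rw [Real.rpow_sub h, Real.rpow_one, div_le_iff₀ (by positivity), mul_comm]
      exact hrec j
    -- The ratio `ρ = b^(-1/σ)` is the one with `b ρ = ρ^(1-σ)`, which makes the induction close.
    have hbρ : b ^ j * ρ ^ j = (ρ ^ j) ^ (1 - σ) := by
      rw [Real.rpow_sub (by positivity), Real.rpow_one, ← Real.rpow_natCast, ← Real.rpow_natCast,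
        hρ, ← Real.rpow_mul hb0.le, ← Real.rpow_mul hb0.le,
        show -(1 / σ) * (j : ℝ) * σ = -(j : ℝ) by field_simp, Real.rpow_neg hb0.le, div_inv_eq_mul]
      ring
    have hρ1 : b ^ (-((1 - σ) / σ)) = ρ ^ (1 - σ) := by
      rw [hρ, ← Real.rpow_mul hb0.le]; congr 1; ring
    have e2 : y (j + 1) ^ (1 - σ) ≤ (y 0 * ρ ^ (j + 1)) ^ (1 - σ) := by
      calc y (j + 1) ^ (1 - σ) ≤ L * b ^ j * (y 0 * ρ ^ j) :=
            e1.trans (by gcongr)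
        _ = (L * y 0 ^ σ) * (y 0 ^ (1 - σ)) * (b ^ j * ρ ^ j) := by
            rw [Real.rpow_sub h00, Real.rpow_one]; field_simp
        _ ≤ ρ ^ (1 - σ) * (y 0 ^ (1 - σ)) * (ρ ^ j) ^ (1 - σ) := by
            rw [hbρ, ← hρ1]; gcongr
        _ = _ := by
            rw [pow_succ, Real.mul_rpow (by positivity) (by positivity),
              Real.mul_rpow (by positivity) (by positivity)]
            ring
    exact (Real.rpow_le_rpow_iff h.le (by positivity) (by linarith)).1 e2

/-- Each of the two powers of `M` is made to contribute at most 1. Since `D ≥ 1`, the single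
exponent `1/(q-γ)` on `D` serves both. -/
theorem critical_level_bound {γ q e D U : ℝ} (hγ : 1 ≤ γ) (hγq : γ < q) (hD : 1 ≤ D)
    (hU : 0 < U) {M : ℝ}
    (hM : M = D ^ (1 / (q - γ)) * max (U ^ (e / (q - 1))) (U ^ (e / (q - γ)))) :
    D * U ^ e * (M ^ (1 - q) + M ^ (γ - q)) ≤ 2 := by
  have hD0 : 0 < D := by linarith
  have hqγ : 0 < q - γ := by linarith
  have hMpos : 0 < M := by
    rw [hM]; have : 0 < U ^ (e / (q - 1)) := by positivity
    exact mul_pos (by positivity) (lt_max_of_lt_left this)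
  have key : ∀ ρ : ℝ, 1 ≤ ρ → ρ ≤ γ → D ^ (1 / (q - γ)) * U ^ (e / (q - ρ)) ≤ M →
      D * U ^ e * M ^ (ρ - q) ≤ 1 := by
    intro ρ h1 h2 h3
    have hqρ : 0 < q - ρ := by linarith
    have e1 : D * U ^ e ≤ M ^ (q - ρ) := by
      calc D * U ^ e ≤ D ^ ((q - ρ) / (q - γ)) * U ^ e := by
            gcongr
            refine Real.self_le_rpow_of_one_le hD ?_
            rw [le_div_iff₀ hqγ]; linarith
        _ = (D ^ (1 / (q - γ)) * U ^ (e / (q - ρ))) ^ (q - ρ) := by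
            rw [Real.mul_rpow (by positivity) (by positivity), ← Real.rpow_mul hD0.le,
              ← Real.rpow_mul hU.le]
            congr 2
            · ring
            · field_simp
        _ ≤ M ^ (q - ρ) := by gcongr
    rw [show ρ - q = -(q - ρ) by ring, Real.rpow_neg hMpos.le, ← div_eq_mul_inv,
      div_le_one (by positivity)]
    exact e1
  have h1 := key 1 le_rfl hγ (by rw [hM]; gcongr; exact le_max_left _ _)
  have h2 := key γ hγ le_rfl (by rw [hM]; gcongr; exact le_max_right _ _)
  linarith

/-- For `U ≤ 1` the smaller exponent dominates; for `U > 1` the bound `U ≤ B` absorbs `U^m` into the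
constant. -/
theorem max_rpow_le {θ m U B : ℝ} (hU : 0 < U) (hθm : θ ≤ m) (hm : 0 ≤ m) (hUB : U ≤ B) :
    max (U ^ θ) (U ^ m) ≤ (1 + B) ^ m * max (U ^ θ) U := by
  have hB : 0 < B := hU.trans_le hUB
  have h1 : 1 ≤ (1 + B) ^ m := Real.one_le_rpow (by linarith) hm
  have hmax : 0 < max (U ^ θ) U := lt_max_of_lt_right hU
  refine max_le ((le_max_left _ _).trans (le_mul_of_one_le_left hmax.le h1)) ?_
  rcases le_or_gt U 1 with h | h
  · refine le_trans ?_ (le_mul_of_one_le_left hmax.le h1)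
    exact (Real.rpow_le_rpow_of_exponent_ge hU h hθm).trans (le_max_left _ _)
  · calc U ^ m ≤ (1 + B) ^ m * 1 := by rw [mul_one]; gcongr; linarith
      _ ≤ _ := by gcongr; exact h.le.trans (le_max_right _ _)

/-! ### Truncations as test functions -/

/-- Truncation is nondecreasing and 1-Lipschitz, so its increment `d` satisfies `d² ≤ (x - y) d` and
`|d| ≤ |x - y|`; here `p ≥ 2` is what allows `|d|^(p-2) ≤ |x - y|^(p-2)`. -/
theorem monotone_truncation_inequality {p : ℝ} (hp : 2 ≤ p) {x y k : ℝ} :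
    |max (x - k) 0 - max (y - k) 0| ^ p ≤
      |x - y| ^ (p - 2) * (x - y) * (max (x - k) 0 - max (y - k) 0) := by
  set d := max (x - k) 0 - max (y - k) 0 with hd
  have h1 : d ^ 2 ≤ (x - y) * d := by
    rcases max_cases (x - k) 0 with ⟨h, h'⟩ | ⟨h, h'⟩ <;>
    rcases max_cases (y - k) 0 with ⟨g, g'⟩ | ⟨g, g'⟩ <;>
    rw [hd, h, g] <;> nlinarith
  have h2 : |d| ≤ |x - y| := by
    rw [hd]
    refine (abs_max_sub_max_le_max _ _ _ _).trans ?_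
    simp
  rcases eq_or_ne d 0 with h0 | h0
  · rw [h0, abs_zero, Real.zero_rpow (by linarith), mul_zero]
  have hdpos : 0 < |d| := abs_pos.2 h0
  calc |d| ^ p = |d| ^ (p - 2) * d ^ 2 := by
        rw [← sq_abs, ← Real.rpow_natCast |d| 2, ← Real.rpow_add hdpos]; congr 1; norm_num
    _ ≤ |x - y| ^ (p - 2) * ((x - y) * d) := by
        gcongr
    _ = _ := by ring

theorem abs_truncation_sub_le (x y k : ℝ) :
    |max (x - k) 0 - max (y - k) 0| ≤ |x - y| := by
  refine (abs_max_sub_max_le_max _ _ _ _).trans ?_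
  simp

theorem critExp_pos {N : ℕ} {s p : ℝ} (hN : 0 < N) (hp : 0 < p) (h : s * p < N) :
    0 < critExp N s p := by
  have : (0 : ℝ) < N := by exact_mod_cast hN
  unfold critExp
  exact div_pos (by positivity) (by linarith)

theorem gagliardo_mono {N : ℕ} {s p : ℝ} (hp : 0 < p) {u w : RN N → ℝ}
    (h : ∀ x y, |w x - w y| ≤ |u x - u y|) : gagliardo N s p w ≤ gagliardo N s p u := by
  unfold gagliardo
  refine ENNReal.rpow_le_rpow (lintegral_mono fun z => ENNReal.ofReal_le_ofReal ?_) (by positivity)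
  have := h z.1 z.2
  gcongr ?_ ^ p / _

theorem MemD.neg {N : ℕ} {s p : ℝ} {u : RN N → ℝ} (hp : 0 < p) (hu : MemD N s p u) :
    MemD N s p (fun x => -u x) := by
  refine ⟨hu.1.neg, (gagliardo_mono hp fun x y => ?_).trans_lt hu.2⟩
  rw [← abs_neg]; ring_nf; exact le_rfl

theorem abs_truncation_le (x : ℝ) {k : ℝ} (hk : 0 ≤ k) : |max (x - k) 0| ≤ |x| := by
  rw [abs_of_nonneg (le_max_right _ _)]
  exact max_le (by linarith [le_abs_self x]) (abs_nonneg _)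

theorem MemD.truncation {N : ℕ} {s p : ℝ} {u : RN N → ℝ} (hp : 0 < p) (hu : MemD N s p u)
    {k : ℝ} (hk : 0 ≤ k) : MemD N s p (fun x => max (u x - k) 0) := by
  refine ⟨hu.1.mono ?_ (.of_forall fun x => abs_truncation_le _ hk),
    (gagliardo_mono hp fun x y => abs_truncation_sub_le _ _ _).trans_lt hu.2⟩
  exact (hu.1.aestronglyMeasurable.aemeasurable.sub_const k |>.max
    aemeasurable_const).aestronglyMeasurable

theorem energy_lt_top {N : ℕ} {s p : ℝ} (hp : 0 < p) {u : RN N → ℝ} (hu : MemD N s p u) :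
    energy N s p u < ∞ := by
  have h := hu.2
  rw [gagliardo_eq_energy_rpow] at h
  exact (ENNReal.rpow_lt_top_iff_of_pos (by positivity)).1 h

theorem energy_truncation_le_pairing {N : ℕ} {s p : ℝ} (hp : 2 ≤ p) {u : RN N → ℝ}
    (hu : MemD N s p u) (k : ℝ) :
    energy N s p (fun x => max (u x - k) 0) ≤
      ENNReal.ofReal (pairing N s p u (fun x => max (u x - k) 0)) := by
  have hum : AEMeasurable u := hu.1.aestronglyMeasurable.aemeasurable
  have hu1 : AEMeasurable (fun z : RN N × RN N => u z.1) (volume.prod volume) :=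
    hum.comp_quasiMeasurePreserving Measure.quasiMeasurePreserving_fst
  have hu2 : AEMeasurable (fun z : RN N × RN N => u z.2) (volume.prod volume) :=
    hum.comp_quasiMeasurePreserving Measure.quasiMeasurePreserving_snd
  have hlow : ∀ z : RN N × RN N,
      |max (u z.1 - k) 0 - max (u z.2 - k) 0| ^ p / ‖z.1 - z.2‖ ^ ((N : ℝ) + s * p) ≤
        |u z.1 - u z.2| ^ (p - 2) * (u z.1 - u z.2) * (max (u z.1 - k) 0 - max (u z.2 - k) 0)
          / ‖z.1 - z.2‖ ^ ((N : ℝ) + s * p) := fun z => by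
    gcongr
    exact monotone_truncation_inequality hp
  have hnonneg : ∀ z : RN N × RN N, 0 ≤
        |u z.1 - u z.2| ^ (p - 2) * (u z.1 - u z.2) * (max (u z.1 - k) 0 - max (u z.2 - k) 0)
          / ‖z.1 - z.2‖ ^ ((N : ℝ) + s * p) := fun z =>
    le_trans (by positivity) (hlow z)
  have hdom : Integrable (fun z : RN N × RN N =>
      |u z.1 - u z.2| ^ p / ‖z.1 - z.2‖ ^ ((N : ℝ) + s * p)) := by
    refine ⟨AEMeasurable.aestronglyMeasurable (by rw [Measure.volume_eq_prod]; fun_prop), ?_⟩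
    rw [hasFiniteIntegral_iff_ofReal (.of_forall fun z => by positivity)]
    exact energy_lt_top (by linarith) hu
  -- A Bochner integral defaults to 0 without integrability; the energy density of `u` is the
  -- dominating function.
  have hint : Integrable (fun z : RN N × RN N =>
      |u z.1 - u z.2| ^ (p - 2) * (u z.1 - u z.2) * (max (u z.1 - k) 0 - max (u z.2 - k) 0)
          / ‖z.1 - z.2‖ ^ ((N : ℝ) + s * p)) := by
    refine hdom.mono' (AEMeasurable.aestronglyMeasurable
      (by rw [Measure.volume_eq_prod]; fun_prop)) (.of_forall fun z => ?_)
    rw [norm_div, norm_mul, norm_mul, Real.norm_eq_abs, Real.norm_eq_abs, Real.norm_eq_abs,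
      Real.norm_of_nonneg (by positivity : (0 : ℝ) ≤ ‖z.1 - z.2‖ ^ ((N : ℝ) + s * p))]
    gcongr
    rw [abs_of_nonneg (by positivity : (0 : ℝ) ≤ |u z.1 - u z.2| ^ (p - 2)), mul_assoc]
    rcases (abs_nonneg (u z.1 - u z.2)).eq_or_lt with h0 | h0
    · rw [← h0]; simp; positivity
    calc |u z.1 - u z.2| ^ (p - 2) * (|u z.1 - u z.2| * |max (u z.1 - k) 0 - max (u z.2 - k) 0|)
        ≤ |u z.1 - u z.2| ^ (p - 2) * (|u z.1 - u z.2| * |u z.1 - u z.2|) := by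
          gcongr ?_ * (?_ * ?_)
          exact abs_truncation_sub_le _ _ _
      _ = |u z.1 - u z.2| ^ p := by
          rw [← sq, ← Real.rpow_natCast _ 2, ← Real.rpow_add h0]; congr 1; norm_num
  rw [pairing, ofReal_integral_eq_lintegral_ofReal hint (.of_forall hnonneg)]
  exact lintegral_mono fun z => ENNReal.ofReal_le_ofReal (hlow z)

/-- The Caccioppoli inequality for truncations of a weak solution. -/
theorem energy_truncation_le {N : ℕ} {s p γ A : ℝ} (hp : 2 ≤ p) (hA : 0 ≤ A)
    {g : RN N → ℝ → ℝ} {u : RN N → ℝ}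
    (hg : ∀ᵐ x : RN N, ∀ t : ℝ, |g x t| ≤ A * (1 + |t| ^ (γ - 1)))
    (hu : IsWeakSolution N s p g u) {k : ℝ} (hk : 0 ≤ k) :
    energy N s p (fun x => max (u x - k) 0) ≤ ENNReal.ofReal A *
      ∫⁻ x, ENNReal.ofReal ((1 + |u x| ^ (γ - 1)) * max (u x - k) 0) := by
  obtain ⟨hint, heq⟩ := hu.2 _ (hu.1.truncation (by linarith) hk)
  refine (energy_truncation_le_pairing hp hu.1 k).trans ?_
  rw [heq, ← lintegral_const_mul' _ _ ENNReal.ofReal_ne_top]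
  refine (ENNReal.ofReal_le_ofReal (integral_mono hint hint.norm fun x => le_abs_self _)).trans ?_
  rw [ofReal_integral_eq_lintegral_ofReal hint.norm (.of_forall fun x => norm_nonneg _)]
  refine lintegral_mono_ae ?_
  filter_upwards [hg] with x hx
  rw [← ENNReal.ofReal_mul hA]
  refine ENNReal.ofReal_le_ofReal ?_
  have h0 : 0 ≤ max (u x - k) 0 := le_max_right _ _
  rw [norm_mul, Real.norm_of_nonneg h0, ← mul_assoc]
  exact mul_le_mul_of_nonneg_right (hx _) h0

/-- The operator is odd; this converts upper bounds for solutions into lower bounds. -/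
theorem IsWeakSolution.neg {N : ℕ} {s p : ℝ} (hp : 0 < p) {g : RN N → ℝ → ℝ} {u : RN N → ℝ}
    (hu : IsWeakSolution N s p g u) :
    IsWeakSolution N s p (fun x t => -g x (-t)) (fun x => -u x) := by
  refine ⟨hu.1.neg hp, fun v hv => ?_⟩
  obtain ⟨h1, h2⟩ := hu.2 _ (hv.neg hp)
  have e : (fun x => -g x (- -u x) * v x) = fun x => g x (u x) * -v x := by
    ext x; rw [neg_neg]; ring
  rw [e]
  refine ⟨h1, ?_⟩
  rw [← h2]
  unfold pairing
  congr 1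
  ext z
  rw [show -u z.1 - -u z.2 = -(u z.1 - u z.2) by ring, abs_neg]
  ring

theorem powInt_mono {N : ℕ} {q : ℝ} (hq : 0 ≤ q) {v w : RN N → ℝ} (h : ∀ x, |v x| ≤ |w x|) :
    powInt N q v ≤ powInt N q w :=
  lintegral_mono fun x => ENNReal.ofReal_le_ofReal
    (Real.rpow_le_rpow (abs_nonneg _) (h x) hq)

theorem powInt_eq_eLpNorm_rpow {N : ℕ} {q : ℝ} (hq : 0 < q) (u : RN N → ℝ) :
    powInt N q u = eLpNorm u (ENNReal.ofReal q) volume ^ q := by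
  rw [eLpNorm_eq_lintegral_rpow_enorm_toReal (by simpa using hq) ENNReal.ofReal_ne_top,
    ENNReal.toReal_ofReal hq.le, ← ENNReal.rpow_mul, one_div_mul_cancel hq.ne', ENNReal.rpow_one]
  refine lintegral_congr fun x => ?_
  rw [← Real.norm_eq_abs, ← ofReal_norm, ENNReal.ofReal_rpow_of_nonneg (norm_nonneg _) hq.le]

/-! ### De Giorgi iteration and the `L^∞` bound -/

/-- De Giorgi iteration along the levels `M (1 - 2^{-j})`. -/
theorem ae_le_of_energy_truncation_le {N : ℕ} {s p q σ γ A M : ℝ} (hN : 0 < N) (hp : 0 < p)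
    (hq : 0 < q) (hs : 0 < s) (hσ : σ = s * p / N) (hσ0 : 0 < σ) (hσ1 : σ < 1)
    (hqσ : p + q * σ = q) (hγ : 1 ≤ γ) (hγq : γ < q) (hA : 0 ≤ A) (hM : 0 < M)
    {u : RN N → ℝ} (hu : AEMeasurable u) (hfin : powInt N q u ≠ ∞)
    (henergy : ∀ k : ℝ, 0 ≤ k → energy N s p (fun x => max (u x - k) 0) ≤ ENNReal.ofReal A *
      ∫⁻ x, ENNReal.ofReal ((1 + |u x| ^ (γ - 1)) * max (u x - k) 0))
    (hsmall : sobolevConst N q σ * A * 4 ^ q * (M ^ (1 - q) + M ^ (γ - q)) *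
      (powInt N q u).toReal ^ σ ≤ (2 ^ q) ^ (-((1 - σ) / σ))) :
    ∀ᵐ x, u x ≤ M := by
  set K := sobolevConst N q σ with hK
  have hKpos : 0 < K := sobolevConst_pos N q σ
  set w : ℕ → RN N → ℝ := fun j x => max (u x - M * (1 - (1 / 2) ^ j)) 0 with hw
  have hlev : ∀ j : ℕ, 0 ≤ M * (1 - (1 / 2 : ℝ) ^ j) := fun j => by
    have : (1 / 2 : ℝ) ^ j ≤ 1 := pow_le_one₀ (by norm_num) (by norm_num)
    exact mul_nonneg hM.le (by linarith)
  have hle : ∀ j, powInt N q (w j) ≤ powInt N q u := fun j =>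
    powInt_mono hq.le fun x => abs_truncation_le _ (hlev j)
  have hwfin : ∀ j, powInt N q (w j) ≠ ∞ := fun j => ne_top_of_le_ne_top hfin (hle j)
  set y : ℕ → ℝ := fun j => (powInt N q (w j)).toReal with hy
  set L : ℝ := K * A * 4 ^ q * (M ^ (1 - q) + M ^ (γ - q)) with hL
  have hLnn : 0 ≤ L := by positivity
  have hynn : ∀ j, 0 ≤ y j := fun j => ENNReal.toReal_nonneg
  have hrec : ∀ j, y (j + 1) ≤ y (j + 1) ^ σ * (L * (2 ^ q) ^ j * y j) := by
    intro j
    have hc : (0 : ℝ) ≤ 4 ^ q * (2 ^ q) ^ j * (M ^ (1 - q) + M ^ (γ - q)) := by positivity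
    have h1 : energy N s p (w (j + 1)) ≤ ENNReal.ofReal A *
        (ENNReal.ofReal (4 ^ q * (2 ^ q) ^ j * (M ^ (1 - q) + M ^ (γ - q))) *
          powInt N q (w j)) := by
      refine (henergy _ (hlev (j + 1))).trans ?_
      gcongr
      rw [powInt, ← lintegral_const_mul' _ _ ENNReal.ofReal_ne_top]
      refine lintegral_mono fun x => ?_
      rw [← ENNReal.ofReal_mul hc]
      exact ENNReal.ofReal_le_ofReal (levelset_growth_bound hM hγ hγq j)
    have hwm : AEMeasurable (w (j + 1)) := (hu.sub_const _).max aemeasurable_const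
    have h2 := powInt_le_energy hN hp hq hs hσ hqσ hwm (hwfin (j + 1))
    have h3 := h2.trans (mul_le_mul_right h1 _)
    rw [show powInt N q (w j) = ENNReal.ofReal (y j) from (ENNReal.ofReal_toReal (hwfin j)).symm,
      ← ENNReal.ofReal_mul hc, ← ENNReal.ofReal_mul hA,
      ← ENNReal.ofReal_mul (mul_nonneg hKpos.le (Real.rpow_nonneg (hynn (j + 1)) _))] at h3
    have hyj := hynn j
    have hyj1 := hynn (j + 1)
    refine (ENNReal.toReal_le_of_le_ofReal (by positivity) h3).trans (le_of_eq ?_)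
    rw [hL]
    change K * y (j + 1) ^ σ * _ = _
    ring
  have hy0 : y 0 ≤ (powInt N q u).toReal := ENNReal.toReal_mono hfin (hle 0)
  have hdecay := geometric_decay hynn hσ0 hσ1 (Real.one_lt_rpow one_lt_two hq) hLnn hrec
    (le_trans (by have := hynn 0; gcongr) hsmall)
  set ρ : ℝ := (2 ^ q) ^ (-(1 / σ)) with hρ
  have hρ1 : ρ < 1 :=
    Real.rpow_lt_one_of_one_lt_of_neg (Real.one_lt_rpow one_lt_two hq) (by simpa using hσ0)
  -- `M` lies above every level, so `(u - M)₊` is below every `w j`.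
  have hzero : powInt N q (fun x => max (u x - M) 0) = 0 := by
    have hub : ∀ j, powInt N q (fun x => max (u x - M) 0) ≤ ENNReal.ofReal (y 0 * ρ ^ j) := by
      intro j
      refine le_trans (powInt_mono (w := w j) hq.le fun x => ?_)
        (ENNReal.le_ofReal_iff_toReal_le (hwfin j) (mul_nonneg (hynn 0) (by positivity)) |>.2
          (hdecay j))
      rw [abs_of_nonneg (le_max_right _ _), abs_of_nonneg (le_max_right _ _)]
      have : 0 ≤ M * (1 / 2 : ℝ) ^ j := by positivity
      exact max_le_max_right _ (by linarith)
    have hlim : Filter.Tendsto (fun j : ℕ => ENNReal.ofReal (y 0 * ρ ^ j)) Filter.atTop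
        (nhds 0) := by
      have := (tendsto_pow_atTop_nhds_zero_of_lt_one (by positivity) hρ1).const_mul (y 0)
      simpa using ENNReal.tendsto_ofReal this
    exact le_antisymm (ge_of_tendsto' hlim hub) zero_le
  rw [powInt, lintegral_eq_zero_iff' (by fun_prop)] at hzero
  filter_upwards [hzero] with x hx
  by_contra! hlt
  have h1 : 0 < |max (u x - M) 0| := abs_pos.2 (lt_max_of_lt_left (by linarith)).ne'
  have h2 : 0 < |max (u x - M) 0| ^ q := by positivity
  simp only [Pi.zero_apply, ENNReal.ofReal_eq_zero] at hx
  linarith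

/-- The fractional Sobolev inequality. -/
theorem eLpNorm_le_gagliardo {N : ℕ} {s p q σ : ℝ} (hN : 0 < N) (hp : 0 < p)
    (hq : 0 < q) (hs : 0 < s) (hσ : σ = s * p / N) (hqσ : p + q * σ = q)
    {u : RN N → ℝ} (hu : MemLp u (ENNReal.ofReal q)) (hfin : gagliardo N s p u ≠ ∞) :
    (eLpNorm u (ENNReal.ofReal q) volume).toReal ≤
      sobolevConst N q σ ^ (1 / p) * (gagliardo N s p u).toReal := by
  set U := (eLpNorm u (ENNReal.ofReal q) volume).toReal with hU
  set B := (gagliardo N s p u).toReal with hB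
  have hK := sobolevConst_pos N q σ
  have hB0 : 0 ≤ B := ENNReal.toReal_nonneg
  have hU0 : 0 ≤ U := ENNReal.toReal_nonneg
  rcases hU0.eq_or_lt with h0 | hpos
  · rw [← h0]; positivity
  have hI : powInt N q u = ENNReal.ofReal (U ^ q) := by
    rw [powInt_eq_eLpNorm_rpow hq, ← ENNReal.ofReal_rpow_of_nonneg hpos.le hq.le, hU,
      ENNReal.ofReal_toReal hu.2.ne]
  have hE : energy N s p u = ENNReal.ofReal (B ^ p) := by
    rw [← ENNReal.ofReal_rpow_of_nonneg hB0 hp.le, hB, ENNReal.ofReal_toReal hfin,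
      gagliardo_eq_energy_rpow, ← ENNReal.rpow_mul, one_div_mul_cancel hp.ne', ENNReal.rpow_one]
  have h := powInt_le_energy hN hp hq hs hσ hqσ hu.1.aemeasurable (by rw [hI]; simp)
  rw [hI, hE, ENNReal.toReal_ofReal (by positivity), ← ENNReal.ofReal_mul (by positivity),
    ENNReal.ofReal_le_ofReal_iff (by positivity), ← Real.rpow_mul hpos.le] at h
  -- Cancel `U^(qσ)`, using `q = p + qσ`.
  have h1 : U ^ p ≤ sobolevConst N q σ * B ^ p := by
    have e : U ^ q = U ^ p * U ^ (q * σ) := by rw [← Real.rpow_add hpos, hqσ]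
    have : 0 < U ^ (q * σ) := by positivity
    rw [e] at h
    nlinarith
  refine (Real.rpow_le_rpow_iff hpos.le (by positivity) hp).1 (h1.trans (le_of_eq ?_))
  rw [Real.mul_rpow (by positivity) hB0, ← Real.rpow_mul hK.le, one_div_mul_cancel hp.ne',
    Real.rpow_one]

/-- The constant of the iteration, as a function of the bound `A` on the coefficient. -/
noncomputable def iterConst (N : ℕ) (q σ A : ℝ) : ℝ :=
  1 + 2 * (sobolevConst N q σ * 4 ^ q) / (2 ^ q) ^ (-((1 - σ) / σ)) * A

theorem one_le_iterConst (N : ℕ) (q σ : ℝ) {A : ℝ} (hA : 0 ≤ A) : 1 ≤ iterConst N q σ A := by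
  have := sobolevConst_pos N q σ
  unfold iterConst
  exact le_add_of_nonneg_right (by positivity)

theorem iterConst_mono (N : ℕ) (q σ : ℝ) {A A' : ℝ} (h : A ≤ A') :
    iterConst N q σ A ≤ iterConst N q σ A' := by
  have := sobolevConst_pos N q σ
  unfold iterConst
  gcongr

/-- The factor 2 in `iterConst` matches the 2 in `critical_level_bound`; its summand 1 supplies the
requirement `D ≥ 1` there. -/
theorem smallness_of_iterConst {N : ℕ} {q σ A X : ℝ} (hX : 0 ≤ X)
    (h : iterConst N q σ A * X ≤ 2) :
    sobolevConst N q σ * A * 4 ^ q * X ≤ (2 ^ q) ^ (-((1 - σ) / σ)) := by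
  set c : ℝ := (2 ^ q) ^ (-((1 - σ) / σ)) with hc
  have hcpos : 0 < c := by positivity
  have h1 : 2 * (sobolevConst N q σ * 4 ^ q) / c * A * X ≤ 2 := by
    refine le_trans ?_ h
    rw [iterConst, ← hc, add_mul]
    linarith
  rw [show 2 * (sobolevConst N q σ * 4 ^ q) / c * A * X =
    2 * (sobolevConst N q σ * A * 4 ^ q * X) / c by ring, div_le_iff₀ hcpos] at h1
  linarith

/-- The `L^∞` bound in terms of the `L^q` norm, for solutions with coefficient bounded by `A`. -/
theorem ae_abs_le_of_isWeakSolution {N : ℕ} {s p q σ γ A U : ℝ} (hN : 0 < N) (hp : 2 ≤ p)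
    (hs : 0 < s) (hσ : σ = s * p / N) (hσ0 : 0 < σ) (hσ1 : σ < 1)
    (hqσ : p + q * σ = q) (hγ : 1 ≤ γ) (hγq : γ < q) (hA : 0 ≤ A)
    {g : RN N → ℝ → ℝ} {u : RN N → ℝ}
    (hg : ∀ᵐ x : RN N, ∀ t : ℝ, |g x t| ≤ A * (1 + |t| ^ (γ - 1)))
    (hu : IsWeakSolution N s p g u) (hU : 0 < U)
    (hUu : eLpNorm u (ENNReal.ofReal q) volume = ENNReal.ofReal U) :
    ∀ᵐ x, |u x| ≤ iterConst N q σ A ^ (1 / (q - γ)) *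
      max (U ^ ((q - p) / (q - 1))) (U ^ ((q - p) / (q - γ))) := by
  have hp0 : 0 < p := by linarith
  have hq0 : 0 < q := by linarith
  have hD := one_le_iterConst N q σ hA
  obtain ⟨M, hM⟩ : ∃ M, M = iterConst N q σ A ^ (1 / (q - γ)) *
      max (U ^ ((q - p) / (q - 1))) (U ^ ((q - p) / (q - γ))) := ⟨_, rfl⟩
  rw [← hM]
  have hMpos : 0 < M := by
    rw [hM]
    have h1 : 0 < U ^ ((q - p) / (q - 1)) := by positivity
    exact mul_pos (Real.rpow_pos_of_pos (by linarith) _) (lt_max_of_lt_left h1)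
  have hcrit := critical_level_bound hγ hγq hD hU hM
  -- The factor `U^(q-p)` is `(∫ |u|^q)^σ`, since `qσ = q - p`.
  have hsmall := smallness_of_iterConst (N := N) (q := q) (σ := σ) (A := A)
    (X := (M ^ (1 - q) + M ^ (γ - q)) * U ^ (q - p)) (by positivity)
    (le_trans (le_of_eq (by ring)) hcrit)
  have upper : ∀ (f : RN N → ℝ → ℝ) (v : RN N → ℝ),
      (∀ᵐ x : RN N, ∀ t : ℝ, |f x t| ≤ A * (1 + |t| ^ (γ - 1))) → IsWeakSolution N s p f v →
      powInt N q v = ENNReal.ofReal (U ^ q) → ∀ᵐ x, v x ≤ M := by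
    intro f v hf hv hI
    refine ae_le_of_energy_truncation_le hN hp0 hq0 hs hσ hσ0 hσ1 hqσ hγ hγq hA hMpos
      hv.1.1.aestronglyMeasurable.aemeasurable (by rw [hI]; simp)
      (fun k hk => energy_truncation_le hp hA hf hv hk) ?_
    rw [hI, ENNReal.toReal_ofReal (by positivity), ← Real.rpow_mul hU.le,
      show q * σ = q - p by linarith, mul_assoc]
    exact hsmall
  have hI : powInt N q u = ENNReal.ofReal (U ^ q) := by
    rw [powInt_eq_eLpNorm_rpow hq0, hUu, ENNReal.ofReal_rpow_of_nonneg hU.le hq0.le]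
  have h1 := upper g u hg hu hI
  have h2 := upper _ _ (hg.mono fun x hx t => by simpa using hx (-t)) (hu.neg hp0)
    (by rw [← hI]; simp [powInt])
  filter_upwards [h1, h2] with x hx1 hx2
  exact abs_le.2 ⟨by linarith, hx1⟩

end FracPLaplace

/-! ### Main theorem -/

theorem corollary2p6 (N : ℕ) (s p : ℝ) (hs0 : 0 < s) (hs1 : s < 1) (hp : 2 ≤ p)
    (hpN : p < N / s) :
    ∃ θ₀ : ℝ, 0 < θ₀ ∧ θ₀ ≤ 1 ∧
      ∀ γ : ℝ, 1 ≤ γ → γ < FracPLaplace.critExp N s p →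
        ∃ C : ℝ≥0 → ℝ≥0 → ℝ≥0,
          (∀ A A' B B' : ℝ≥0, A ≤ A' → B ≤ B' → C A B ≤ C A' B') ∧
          ∀ (a : FracPLaplace.RN N → ℝ) (g : FracPLaplace.RN N → ℝ → ℝ)
            (u : FracPLaplace.RN N → ℝ),
            MemLp a 1 volume → MemLp a ∞ volume →
            FracPLaplace.HypG N γ a g →
            FracPLaplace.IsWeakSolution N s p g u →
            eLpNorm u ∞ volume ≤
              (C (FracPLaplace.normOneInfty N a).toNNReal
                  (FracPLaplace.gagliardo N s p u).toNNReal : ℝ≥0∞) *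
                max (eLpNorm u (ENNReal.ofReal (FracPLaplace.critExp N s p)) volume ^ θ₀)
                  (eLpNorm u (ENNReal.ofReal (FracPLaplace.critExp N s p)) volume) := by
  have hp0 : 0 < p := by linarith
  have hspN : s * p < N := by
    rw [lt_div_iff₀ hs0] at hpN; linarith
  have hsp : 0 < s * p := by positivity
  have hNR : (0 : ℝ) < N := by linarith
  have hN : 0 < N := by exact_mod_cast hNR
  obtain ⟨q, hq⟩ : ∃ q, q = FracPLaplace.critExp N s p := ⟨_, rfl⟩
  obtain ⟨σ, hσ⟩ : ∃ σ, σ = s * p / N := ⟨_, rfl⟩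
  have hσ0 : 0 < σ := by rw [hσ]; positivity
  have hσ1 : σ < 1 := by rw [hσ, div_lt_one hNR]; exact hspN
  have hqσ : p + q * σ = q := by
    rw [hq, hσ]; exact FracPLaplace.exponent_identity hNR hspN
  have hq0 : 0 < q := by rw [hq]; exact FracPLaplace.critExp_pos hN hp0 hspN
  have hqp : p < q := by linarith [mul_pos hq0 hσ0]
  have hq1 : 0 < q - 1 := by linarith
  rw [← hq]
  -- `θ₀` comes from the constant term 1 of the growth bound, hence does not depend on `γ`.
  refine ⟨(q - p) / (q - 1), div_pos (by linarith) hq1, by rw [div_le_one hq1]; linarith,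
    fun γ hγ hγq => ?_⟩
  have hqγ : 0 < q - γ := by linarith
  set K := FracPLaplace.sobolevConst N q σ with hK
  have hKpos : 0 < K := FracPLaplace.sobolevConst_pos N q σ
  set F : ℝ≥0 → ℝ≥0 → ℝ := fun A B => FracPLaplace.iterConst N q σ A ^ (1 / (q - γ)) *
    (1 + K ^ (1 / p) * B) ^ ((q - p) / (q - γ)) with hF
  have hm : 0 ≤ (q - p) / (q - γ) := div_nonneg (by linarith) hqγ.le
  have hiter : ∀ A : ℝ≥0, 1 ≤ FracPLaplace.iterConst N q σ A := fun A =>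
    FracPLaplace.one_le_iterConst N q σ A.2
  refine ⟨fun A B => (F A B).toNNReal, fun A A' B B' hA hB => Real.toNNReal_le_toNNReal ?_,
    fun a g u ha1 ha hg hu => ?_⟩
  · have h1 := hiter A
    have h2 := FracPLaplace.iterConst_mono N q σ (NNReal.coe_le_coe.2 hA)
    have hB' : (B : ℝ) ≤ B' := hB
    have h3 : 0 ≤ FracPLaplace.iterConst N q σ A' := by linarith
    simp only [hF]
    gcongr
  set A : ℝ≥0 := (FracPLaplace.normOneInfty N a).toNNReal with hAdef
  set B : ℝ≥0 := (FracPLaplace.gagliardo N s p u).toNNReal with hBdef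
  have hmem : MemLp u (ENNReal.ofReal q) volume := by rw [hq]; exact hu.1.1
  -- If the `L^q` norm vanishes then `u = 0` a.e.; the real-power estimates below need `U > 0`.
  rcases eq_or_ne (eLpNorm u (ENNReal.ofReal q) volume) 0 with h0 | h0
  · rw [eLpNorm_eq_zero_iff hmem.1 (by simpa using hq0)] at h0
    rw [eLpNorm_congr_ae h0]
    simp
  obtain ⟨U, hUdef⟩ : ∃ U, U = (eLpNorm u (ENNReal.ofReal q) volume).toReal := ⟨_, rfl⟩
  have hUpos : 0 < U := by rw [hUdef]; exact ENNReal.toReal_pos h0 hmem.2.ne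
  have hUu : eLpNorm u (ENNReal.ofReal q) volume = ENNReal.ofReal U := by
    rw [hUdef, ENNReal.ofReal_toReal hmem.2.ne]
  have hnorm : eLpNorm a ∞ volume ≤ A := by
    have hfin : FracPLaplace.normOneInfty N a ≠ ∞ := ENNReal.add_ne_top.2 ⟨ha1.2.ne, ha.2.ne⟩
    rw [hAdef, ENNReal.coe_toNNReal hfin]
    exact le_add_self
  have haA : ∀ᵐ x, |a x| ≤ (A : ℝ) := by
    rw [eLpNorm_exponent_top] at hnorm
    filter_upwards [enorm_ae_le_eLpNormEssSup a volume] with x hx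
    have := hx.trans hnorm
    rw [enorm_eq_nnnorm, ENNReal.coe_le_coe] at this
    exact_mod_cast this
  have hgA : ∀ᵐ x : FracPLaplace.RN N, ∀ t : ℝ, |g x t| ≤ (A : ℝ) * (1 + |t| ^ (γ - 1)) := by
    filter_upwards [hg.2, haA] with x hx hax t
    exact (hx t).trans (by gcongr)
  have hbound := FracPLaplace.ae_abs_le_of_isWeakSolution hN hp hs0 hσ hσ0 hσ1 hqσ hγ
    hγq A.2 hgA hu hUpos hUu
  have hUB : U ≤ K ^ (1 / p) * B := by
    rw [hUdef]
    exact FracPLaplace.eLpNorm_le_gagliardo hN hp0 hq0 hs0 hσ hqσ hmem hu.1.2.ne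
  have hmax := FracPLaplace.max_rpow_le (θ := (q - p) / (q - 1)) hUpos
    (div_le_div_of_nonneg_left (by linarith) hqγ (by linarith)) hm hUB
  have hFnn : 0 ≤ F A B := by
    have := hiter A
    simp only [hF]
    positivity
  rw [hUu, ENNReal.ofReal_rpow_of_pos hUpos, ← ENNReal.ofReal_max, eLpNorm_exponent_top]
  change _ ≤ ENNReal.ofReal (F A B) * _
  rw [← ENNReal.ofReal_mul hFnn]
  refine (eLpNormEssSup_le_of_ae_bound hbound).trans (ENNReal.ofReal_le_ofReal ?_)
  have := hiter A
  simp only [hF]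
  rw [mul_assoc]
  exact mul_le_mul_of_nonneg_left hmax (by positivity)
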